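/- Let $\mathcal H$ be a complex Hilbert space. For a contraction $T$ on $\mathcal H$ let $S_T$ be its asymptotic limit, i.e. the strong limit of $T^{*n}T^n$ as $n\to\infty$. A contraction $T$ is of class $C_{0\cdot}$ if $T^nh\to0$ for every $h$, and of class $C_{1\cdot}$ if $T^nh\not\to0$ for every $h\neq0$. We say that $T$ is Harnack dominated by $T'$, written $T\prec_H T'$, if there is a constant $c\ge1$ such that $\operatorname{Re}p(T)\le c\operatorname{Re}p(T')$ for every complex polynomial $p$ with $\operatorname{Re}p(z)\ge0$ for $|z|\le1$; $T$ and $T'$ are Harnack equivalent if $T\prec_H T'$ and $T'\prec_H T$. The canonical triangulation of $T$ is its matrix with respect to the orthogonal decomposition $\mathcal H=\mathcal N(S_T)\oplus\overline{\mathcal R(S_T)}$ into the null space and the closure of the range of $S_T$. **Theorem.** Let $T$ and $T'$ be commuting contractions on $\mathcal H$ such that $T\prec_H T'$. Then $\mathcal N(S_T)=\mathcal N(S_{T'})$, $\overline{\mathcal R(S_T)}=\overline{\mathcal R(S_{T'})}$, and the canonical triangulations of $T$ and $T'$ have the form $$T=\begin{pmatrix}Q&R\\0&W\end{pmatrix},\qquad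 T'=\begin{pmatrix}Q'&R'\\0&W\end{pmatrix},$$ where $Q,Q'$ are contractions of class $C_{0\cdot}$ on $\mathcal N(S_T)=\mathcal N(S_{T'})$ with $QQ'=Q'Q$ and $Q\prec_H Q'$, and $W$ is a contraction of class $C_{1\cdot}$ on $\overline{\mathcal R(S_T)}$ such that $QR'-Q'R=(R'-R)W$. Moreover, $S_T=S_T^2$ if and only if $S_{T'}=S_{T'}^2$. In this case $S_T=S_{T'}$, $W$ is an isometry and $R=R'=0$; in addition, $T$ and $T'$ are Harnack equivalent if and only if $Q'\prec_H Q$. -/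

import Mathlib

open Filter Topology ComplexStarModule

noncomputable section

variable {H : Type*} [NormedAddCommGroup H] [InnerProductSpace ℂ H]

/-- For a contraction `T`, the operators `T*ⁿ Tⁿ` converge strongly. -/
theorem exists_asymptoticLimit [CompleteSpace H] (T : H →L[ℂ] H) (hT : ‖T‖ ≤ 1) :
    ∃ S : H →L[ℂ] H,
      ∀ x, Tendsto (fun n : ℕ => (ContinuousLinearMap.adjoint T ^ n * T ^ n) x) atTop (𝓝 (S x)) := by
  have hpow : ∀ n : ℕ, ContinuousLinearMap.adjoint T ^ n = ContinuousLinearMap.adjoint (T ^ n) := by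
    intro n
    rw [← ContinuousLinearMap.star_eq_adjoint, ← ContinuousLinearMap.star_eq_adjoint, star_pow]
  have hcontr : ∀ n : ℕ, ‖T ^ n‖ ≤ 1 := fun n => by
    rcases Nat.eq_zero_or_pos n with rfl | hn
    · exact ContinuousLinearMap.norm_id_le
    · exact (norm_pow_le' T hn).trans (pow_le_one₀ (norm_nonneg _) hT)
  have hle : ∀ (n : ℕ) (x : H), ‖(T ^ n) x‖ ≤ ‖x‖ := fun n x => by
    simpa using (T ^ n).le_of_opNorm_le (hcontr n) x
  have hadj : ∀ (n : ℕ) (x : H), ‖ContinuousLinearMap.adjoint (T ^ n) x‖ ≤ ‖x‖ := fun n x => by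
    have h := (ContinuousLinearMap.adjoint (T ^ n)).le_of_opNorm_le
      (c := 1) (by simpa using hcontr n) x
    simpa using h
  set A : ℕ → H →L[ℂ] H := fun n => ContinuousLinearMap.adjoint T ^ n * T ^ n with hA
  have hAle : ∀ (n : ℕ) (x : H), ‖A n x‖ ≤ ‖x‖ := fun n x => by
    simp only [hA, hpow]
    exact (hadj n _).trans (hle n x)
  have hAinner : ∀ (n : ℕ) (x y : H), inner ℂ (A n x) y = inner ℂ ((T ^ n) x) ((T ^ n) y) := by
    intro n x y
    simp only [hA, hpow]
    exact ContinuousLinearMap.adjoint_inner_left (T ^ n) y ((T ^ n) x)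
  have hanti : ∀ x : H, Antitone fun n : ℕ => ‖(T ^ n) x‖ ^ 2 := fun x =>
    antitone_nat_of_succ_le fun n => by
      have h : (T ^ (n + 1)) x = T ((T ^ n) x) := by rw [pow_succ']; rfl
      have := T.le_of_opNorm_le hT ((T ^ n) x)
      rw [h]
      gcongr
      simpa using this
  have key : ∀ (m k : ℕ) (x : H), ‖A m x - A (m + k) x‖ ^ 2 ≤
      ‖(T ^ m) x‖ ^ 2 - ‖(T ^ (m + k)) x‖ ^ 2 := by
    intro m k x
    have e1 : A m x - A (m + k) x =
        ContinuousLinearMap.adjoint (T ^ m) ((T ^ m) x - A k ((T ^ m) x)) := by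
      have : A (m + k) x = ContinuousLinearMap.adjoint (T ^ m) (A k ((T ^ m) x)) := by
        rw [← hpow]
        simp only [hA]
        rw [pow_add (ContinuousLinearMap.adjoint T), add_comm m k, pow_add T]
        rfl
      rw [this, map_sub]
      simp only [hA, hpow]
      rfl
    have e2 : (T ^ (m + k)) x = (T ^ k) ((T ^ m) x) := by
      rw [add_comm, pow_add]; rfl
    rw [e1, e2]
    set y := (T ^ m) x
    have h1 := hadj m (y - A k y)
    have h2 : ‖y - A k y‖ ^ 2 = ‖y‖ ^ 2 - 2 * ‖(T ^ k) y‖ ^ 2 + ‖A k y‖ ^ 2 := by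
      rw [@norm_sub_sq ℂ, ← inner_conj_symm, hAinner, inner_self_eq_norm_sq_to_K]
      congr 2
      norm_cast
    have h3 : ‖A k y‖ ≤ ‖(T ^ k) y‖ := by
      simp only [hA, hpow]
      exact hadj k _
    have h4 : ‖A k y‖ ^ 2 ≤ ‖(T ^ k) y‖ ^ 2 := by gcongr
    calc _ ≤ ‖y - A k y‖ ^ 2 := by gcongr
      _ ≤ _ := by rw [h2]; linarith
  have hcau : ∀ x, CauchySeq fun n => A n x := by
    intro x
    have hconv : CauchySeq fun n : ℕ => ‖(T ^ n) x‖ ^ 2 :=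
      (tendsto_atTop_ciInf (hanti x) ⟨0, by rintro _ ⟨n, rfl⟩; positivity⟩).cauchySeq
    rw [Metric.cauchySeq_iff'] at hconv ⊢
    intro ε hε
    obtain ⟨N, hN⟩ := hconv (ε ^ 2) (by positivity)
    refine ⟨N, fun n hn => ?_⟩
    obtain ⟨k, rfl⟩ := Nat.exists_eq_add_of_le hn
    have h := hN _ hn
    rw [dist_comm, Real.dist_eq] at h
    rw [dist_comm, dist_eq_norm]
    exact lt_of_pow_lt_pow_left₀ 2 hε.le
      ((key N k x).trans_lt ((le_abs_self _).trans_lt h))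
  choose f hf using fun x => cauchySeq_tendsto_of_complete (hcau x)
  refine ⟨LinearMap.mkContinuous
    { toFun := f
      map_add' := fun x y => tendsto_nhds_unique (hf (x + y))
        (by simpa only [map_add] using (hf x).add (hf y))
      map_smul' := fun c x => tendsto_nhds_unique (hf (c • x))
        (by simpa only [map_smul, RingHom.id_apply] using (hf x).const_smul c) } 1 ?_, hf⟩
  intro x
  simpa using le_of_tendsto (hf x).norm (Eventually.of_forall fun n => hAle n x)

open Classical in
/-- The asymptotic limit `S_T`: the strong limit of `T*ⁿ Tⁿ`, which exists for every
contraction `T` (the value `0` is used when there is no strong limit). -/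
def asymptoticLimit [CompleteSpace H] (T : H →L[ℂ] H) : H →L[ℂ] H :=
  if h : ∃ S : H →L[ℂ] H, ∀ x,
      Tendsto (fun n : ℕ => (ContinuousLinearMap.adjoint T ^ n * T ^ n) x) atTop (𝓝 (S x))
  then h.choose else 0

/-- The defining property of the asymptotic limit of a contraction. -/
theorem tendsto_asymptoticLimit [CompleteSpace H] (T : H →L[ℂ] H) (hT : ‖T‖ ≤ 1) (x : H) :
    Tendsto (fun n : ℕ => (ContinuousLinearMap.adjoint T ^ n * T ^ n) x) atTop
      (𝓝 (asymptoticLimit T x)) := by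
  have h := exists_asymptoticLimit T hT
  rw [asymptoticLimit, dif_pos h]
  exact h.choose_spec x

/-- The null space `N(S_T)` of the asymptotic limit. -/
abbrev nullSpaceAL [CompleteSpace H] (T : H →L[ℂ] H) : Submodule ℂ H :=
  (asymptoticLimit T).ker

/-- The closure of the range of the asymptotic limit `S_T`. -/
abbrev closedRangeAL [CompleteSpace H] (T : H →L[ℂ] H) : Submodule ℂ H :=
  (asymptoticLimit T).range.topologicalClosure

/-- `T` is a contraction of class `C_{0·}`: `Tⁿ x → 0` for every `x`. -/
def IsClassC0 (T : H →L[ℂ] H) : Prop :=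
  ‖T‖ ≤ 1 ∧ ∀ x, Tendsto (fun n : ℕ => (T ^ n) x) atTop (𝓝 0)

/-- `T` is a contraction of class `C_{1·}`: `Tⁿ x` does not tend to `0`, for every `x ≠ 0`. -/
def IsClassC1 (T : H →L[ℂ] H) : Prop :=
  ‖T‖ ≤ 1 ∧ ∀ x, x ≠ 0 → ¬ Tendsto (fun n : ℕ => (T ^ n) x) atTop (𝓝 0)

/-- `T` is Harnack dominated by `T'`: there is `c ≥ 1` with `Re p(T) ≤ c Re p(T')` (in the order
of self-adjoint operators) for every polynomial `p` with `Re p ≥ 0` on the closed unit disc. -/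
def HarnackDominated [CompleteSpace H] (T T' : H →L[ℂ] H) : Prop :=
  ∃ c : ℝ, 1 ≤ c ∧ ∀ p : Polynomial ℂ, (∀ z : ℂ, ‖z‖ ≤ 1 → 0 ≤ (p.eval z).re) →
    (ℜ (Polynomial.aeval T p) : H →L[ℂ] H) ≤ c • (ℜ (Polynomial.aeval T' p) : H →L[ℂ] H)

/-- Harnack equivalence: Harnack domination in both directions. -/
def HarnackEquivalent [CompleteSpace H] (T T' : H →L[ℂ] H) : Prop :=
  HarnackDominated T T' ∧ HarnackDominated T' T

/-- `T` has canonical triangulation `(Q R; 0 W)`, the blocks being taken with respect to the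
orthogonal decomposition `H = M ⊕ L`, where `M = N(S_T)` and `L` is the closure of the range
of `S_T`. -/
structure IsCanonicalTriangulation [CompleteSpace H] (T : H →L[ℂ] H) {M L : Submodule ℂ H}
    (Q : M →L[ℂ] M) (R : L →L[ℂ] M) (W : L →L[ℂ] L) : Prop where
  null_eq : M = nullSpaceAL T
  range_eq : L = closedRangeAL T
  ortho : M ⟂ L
  compl : IsCompl M L
  apply_add : ∀ (x : M) (y : L), T ((x : H) + (y : H)) = ((Q x + R y : M) : H) + ((W y : L) : H)

end

/-! Harnack domination is used through one family of test polynomials, the Fejér-type sums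
`fejerPoly`. Averaging their inequalities over roots of unity and then taking Cesàro limits compares
the quadratic forms of the Toeplitz matrices of `T` and `T'` on finitely supported sequences
(`toeplitzForm_le`). Each form telescopes (`toeplitzForm_eq`), and a suitable sequence yields the
key estimate `norm_sum_pow_sub_le`: ‖∑ Tⁿ(T - T')gₙ‖² ≤ c ∑ (‖gₙ‖² - ‖T'gₙ‖²).

The single vector T'ⁿx gives ‖T'ⁿ(T - T')x‖² ≤ c(‖T'ⁿx‖² - ‖T'ⁿ⁺¹x‖²) → 0. The vectors gₖ = Tⁿ⁻ᵏx
give ‖Tⁿ(T - T')x‖² ≤ c‖x‖²/(n+1) → 0. Commutativity moves the powers past T - T'. Hence T - T' maps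
into both N(S_T) and N(S_T').

The form lim ‖Tⁿx‖² is T-invariant and depends only on x modulo N(S_T), so it is also T'-invariant.
This forces the null spaces to coincide, and T, T' to have the same compression W to the orthogonal
complement. If S_T is a projection, the same invariance shows that S_T' is the identity on its
range. Then R = R' = 0, both operators are orthogonal sums with the common summand W, and the
reverse domination only has to be checked on the null space. -/

theorem harnackDominated_iff {H : Type*} [NormedAddCommGroup H] [InnerProductSpace ℂ H]
    [CompleteSpace H] {T T' : H →L[ℂ] H} :
    HarnackDominated T T' ↔ ∃ c : ℝ, 1 ≤ c ∧ ∀ p : Polynomial ℂ,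
      (∀ z : ℂ, ‖z‖ ≤ 1 → 0 ≤ (p.eval z).re) → ∀ x,
        (inner ℂ x (Polynomial.aeval T p x)).re ≤
          c * (inner ℂ x (Polynomial.aeval T' p x)).re := by
  have hre : ∀ (A : H →L[ℂ] H) (x : H),
      inner ℂ x ((ℜ A : H →L[ℂ] H) x) = ((inner ℂ x (A x)).re : ℂ) := by
    intro A x
    rw [realPart_apply_coe]
    have : inner ℂ x ((star A) x) = (starRingEnd ℂ) (inner ℂ x (A x)) := by
      rw [ContinuousLinearMap.star_eq_adjoint, ContinuousLinearMap.adjoint_inner_right,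
        inner_conj_symm]
    rw [smul_apply, add_apply, inner_smul_right_eq_smul,
      inner_add_right, this, Complex.add_conj]
    simp
  unfold HarnackDominated
  refine exists_congr fun c => and_congr_right fun _ => forall₂_congr fun p _ => ?_
  rw [ContinuousLinearMap.le_def, ContinuousLinearMap.isPositive_iff_complex]
  refine forall_congr' fun x => ?_
  have key : inner ℂ ((c • (ℜ (Polynomial.aeval T' p) : H →L[ℂ] H) -
      (ℜ (Polynomial.aeval T p) : H →L[ℂ] H)) x) x =
      ((c * (inner ℂ x (Polynomial.aeval T' p x)).re -
        (inner ℂ x (Polynomial.aeval T p x)).re : ℝ) : ℂ) := by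
    rw [← inner_conj_symm, sub_apply, smul_apply,
      inner_sub_right, inner_smul_right_eq_smul, hre, hre]
    simp
  rw [key]
  simp

/-! ### Fejér-type test polynomials. -/

section Fejer

open Polynomial

/-- The sum of the first `M` Dirichlet-type polynomials `2 ∑_{n ≤ m} (wX)ⁿ - 1`; its real part on
the unit circle is a multiple of the Fejér kernel. -/
noncomputable def fejerPoly (w : ℂ) (M : ℕ) : ℂ[X] :=
  ∑ m ∈ Finset.range M, (2 * ∑ n ∈ Finset.range (m + 1), (C w * X) ^ n - 1)

theorem fejerPoly_eval_re_nonneg {w z : ℂ} (hw : ‖w‖ ≤ 1) (hz : ‖z‖ ≤ 1) (M : ℕ) :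
    0 ≤ ((fejerPoly w M).eval z).re := by
  have hwz : ‖w * z‖ ≤ 1 := by
    rw [norm_mul]; exact mul_le_one₀ hw (norm_nonneg _) hz
  -- The stronger bound by |σ_M|², with σ_M the geometric sum, is what the induction needs: σ_{M+1}
  -- = wzσ_M + 1, so |σ_{M+1}|² ≤ |σ_M|² + 2 Re σ_{M+1} - 1.
  suffices h : ‖∑ n ∈ Finset.range M, (w * z) ^ n‖ ^ 2 ≤ ((fejerPoly w M).eval z).re from
    (sq_nonneg _).trans h
  induction M with
  | zero => simp [fejerPoly]
  | succ M ih =>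
    have h1 : (fejerPoly w (M + 1)).eval z = (fejerPoly w M).eval z +
        (2 * ∑ n ∈ Finset.range (M + 1), (w * z) ^ n - 1) := by
      simp [fejerPoly, Finset.sum_range_succ _ M, eval_finsetSum]
    have h2 : ∑ n ∈ Finset.range (M + 1), (w * z) ^ n =
        (w * z) * ∑ n ∈ Finset.range M, (w * z) ^ n + 1 := by
      rw [Finset.sum_range_succ', Finset.mul_sum]
      simp [pow_succ']
    rw [h1, h2]
    set σ := ∑ n ∈ Finset.range M, (w * z) ^ n
    have h3 : ‖w * z * σ‖ ^ 2 ≤ ‖σ‖ ^ 2 := by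
      rw [norm_mul]
      gcongr
      exact mul_le_of_le_one_left (norm_nonneg _) hwz
    have h4 : ‖w * z * σ + 1‖ ^ 2 = ‖w * z * σ‖ ^ 2 + 2 * (w * z * σ).re + 1 := by
      rw [← Complex.normSq_eq_norm_sq, ← Complex.normSq_eq_norm_sq, Complex.normSq_add]
      simp
      ring
    rw [h4]
    simp only [Complex.add_re, Complex.sub_re, Complex.mul_re, Complex.one_re, Complex.re_ofNat,
      Complex.im_ofNat] at *
    linarith

theorem aeval_fejerPoly {A : Type*} [Ring A] [Algebra ℂ A] (a : A) (w : ℂ) (M : ℕ) :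
    aeval a (fejerPoly w M) =
      ∑ m ∈ Finset.range M, ((2 : ℂ) • ∑ n ∈ Finset.range (m + 1), w ^ n • a ^ n - 1) := by
  simp only [fejerPoly, map_sum, map_sub, map_mul, map_pow, aeval_C, aeval_X, map_one,
    map_ofNat, Algebra.smul_def]
  refine Finset.sum_congr rfl fun m _ => ?_
  congr 2
  refine Finset.sum_congr rfl fun n _ => ?_
  exact Commute.mul_pow (Algebra.commutes w a) n

end Fejer

/-! ### From Harnack domination to Toeplitz forms and the key estimate. -/

section Toeplitz

variable {H : Type*} [NormedAddCommGroup H] [InnerProductSpace ℂ H]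

theorem sum_rootsOfUnity_zpow {K : ℕ} {ζ : ℂ} (hζ : IsPrimitiveRoot ζ K) {m : ℤ}
    (hm : |m| < K) : ∑ k ∈ Finset.range K, ζ ^ ((k : ℤ) * m) = if m = 0 then (K : ℂ) else 0 := by
  split_ifs with h
  · simp [h]
  · have h1 : ζ ^ m ≠ 1 := by
      rw [Ne, hζ.zpow_eq_one_iff_dvd]
      intro hd
      exact h (Int.eq_zero_of_abs_lt_dvd hd hm)
    have h2 : (ζ ^ m) ^ K = 1 := by
      rw [← zpow_natCast, ← zpow_mul, mul_comm, zpow_mul, zpow_natCast, hζ.pow_eq_one, one_zpow]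
    have h3 := mul_neg_geom_sum (ζ ^ m) K
    rw [h2, sub_self, mul_eq_zero, sub_eq_zero] at h3
    rw [← h3.resolve_left (Ne.symm h1)]
    refine Finset.sum_congr rfl fun k _ => ?_
    rw [mul_comm, zpow_mul, zpow_natCast]

/-- Averaging over the roots of unity extracts one diagonal. -/
theorem sum_rootsOfUnity_inner {K N n : ℕ} {ζ : ℂ} (hζ : IsPrimitiveRoot ζ K) (hK : N + n < K)
    (A : H →L[ℂ] H) (h : ℕ → H) (hsupp : ∀ j, N ≤ j → h j = 0) :
    ∑ k ∈ Finset.range K, inner ℂ (∑ i ∈ Finset.range N, ζ ^ (k * i) • h i)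
      (((ζ ^ k)⁻¹) ^ n • A (∑ j ∈ Finset.range N, ζ ^ (k * j) • h j)) =
    (K : ℂ) * ∑ i ∈ Finset.range N, inner ℂ (h i) (A (h (i + n))) := by
  have hK0 : K ≠ 0 := by omega
  have hζ0 : ζ ≠ 0 := hζ.ne_zero hK0
  have hnorm : ‖ζ‖ = 1 := hζ.norm'_eq_one hK0
  have hconj : (starRingEnd ℂ) ζ = ζ⁻¹ := by
    rw [Complex.inv_def, Complex.normSq_eq_norm_sq, hnorm]; simp
  have e1 : ∀ k ∈ Finset.range K, inner ℂ (∑ i ∈ Finset.range N, ζ ^ (k * i) • h i)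
      (((ζ ^ k)⁻¹) ^ n • A (∑ j ∈ Finset.range N, ζ ^ (k * j) • h j)) =
      ∑ i ∈ Finset.range N, ∑ j ∈ Finset.range N,
        ζ ^ ((k : ℤ) * ((j : ℤ) - i - n)) * inner ℂ (h i) (A (h j)) := by
    intro k _
    rw [map_sum, Finset.smul_sum, sum_inner]
    refine Finset.sum_congr rfl fun i _ => ?_
    rw [inner_sum]
    refine Finset.sum_congr rfl fun j _ => ?_
    rw [map_smul, inner_smul_left, inner_smul_right, inner_smul_right, map_pow, hconj,
      ← mul_assoc, ← mul_assoc]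
    congr 1
    rw [mul_sub, mul_sub, zpow_sub₀ hζ0, zpow_sub₀ hζ0, inv_pow, inv_pow, ← pow_mul]
    norm_cast
    field_simp
  rw [Finset.sum_congr rfl e1, Finset.sum_comm, Finset.mul_sum]
  refine Finset.sum_congr rfl fun i hi => ?_
  rw [Finset.sum_comm]
  simp_rw [← Finset.sum_mul]
  have e2 : ∀ j ∈ Finset.range N,
      (∑ k ∈ Finset.range K, ζ ^ ((k : ℤ) * ((j : ℤ) - i - n))) * inner ℂ (h i) (A (h j)) =
      if j = i + n then (K : ℂ) * inner ℂ (h i) (A (h j)) else 0 := by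
    intro j hj
    rw [Finset.mem_range] at hi hj
    -- Since i, j < N and N + n < K, the exponent j - i - n has absolute value below K, so there is
    -- no aliasing.
    rw [sum_rootsOfUnity_zpow hζ (by rw [abs_lt]; omega)]
    by_cases hji : j = i + n
    · rw [if_pos (by omega), if_pos hji]
    · rw [if_neg (by omega), if_neg hji, zero_mul]
  rw [Finset.sum_congr rfl e2, Finset.sum_ite_eq']
  split_ifs with hin
  · rfl
  · rw [Finset.mem_range, not_lt] at hin
    simp [hsupp _ hin]

/-- Partial sums `2 ∑_{n ≤ m} ∑_i Re ⟨h i, Tⁿ h (i+n)⟩ - ∑_i ‖h i‖²` of the quadratic form of the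
Toeplitz matrix of `T`. -/
noncomputable def toeplitzForm (T : H →L[ℂ] H) (N : ℕ) (h : ℕ → H) (m : ℕ) : ℝ :=
  2 * ∑ n ∈ Finset.range (m + 1), (∑ i ∈ Finset.range N, inner ℂ (h i) ((T ^ n) (h (i + n)))).re -
    ∑ i ∈ Finset.range N, ‖h i‖ ^ 2

theorem toeplitzForm_of_le (T : H →L[ℂ] H) {N m : ℕ} (hm : N ≤ m) (h : ℕ → H)
    (hsupp : ∀ j, N ≤ j → h j = 0) : toeplitzForm T N h m = toeplitzForm T N h N := by
  unfold toeplitzForm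
  congr 2
  symm
  refine Finset.sum_subset (Finset.range_mono (by omega)) fun n _ hn => ?_
  rw [Finset.mem_range, not_lt] at hn
  have h0 : ∀ i ∈ Finset.range N, inner ℂ (h i) ((T ^ n) (h (i + n))) = 0 := fun i _ => by
    rw [hsupp (i + n) (by omega), map_zero, inner_zero_right]
  rw [Finset.sum_eq_zero h0, Complex.zero_re]

theorem sum_rootsOfUnity_fejerPoly {K N M : ℕ} {ζ : ℂ} (hζ : IsPrimitiveRoot ζ K)
    (hK : N + M < K) (T : H →L[ℂ] H) (h : ℕ → H) (hsupp : ∀ j, N ≤ j → h j = 0) :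
    ∑ k ∈ Finset.range K, (inner ℂ (∑ i ∈ Finset.range N, ζ ^ (k * i) • h i)
      (Polynomial.aeval T (fejerPoly ((ζ ^ k)⁻¹) M)
        (∑ j ∈ Finset.range N, ζ ^ (k * j) • h j))).re =
    K * ∑ m ∈ Finset.range M, toeplitzForm T N h m := by
  set g : ℕ → H := fun k => ∑ i ∈ Finset.range N, ζ ^ (k * i) • h i with hg
  have e1 : ∀ k, inner ℂ (g k) (Polynomial.aeval T (fejerPoly ((ζ ^ k)⁻¹) M) (g k)) =
      ∑ m ∈ Finset.range M, (2 * ∑ n ∈ Finset.range (m + 1),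
        inner ℂ (g k) (((ζ ^ k)⁻¹) ^ n • (T ^ n) (g k)) -
        inner ℂ (g k) (((ζ ^ k)⁻¹) ^ 0 • (1 : H →L[ℂ] H) (g k))) := by
    intro k
    rw [aeval_fejerPoly]
    simp only [sum_apply, sub_apply, smul_apply, inner_sum, inner_sub_right, inner_smul_right,
      pow_zero, one_smul]
  have e2 : ∑ k ∈ Finset.range K, inner ℂ (g k)
      (Polynomial.aeval T (fejerPoly ((ζ ^ k)⁻¹) M) (g k)) =
      (K : ℂ) * ∑ m ∈ Finset.range M, (2 * ∑ n ∈ Finset.range (m + 1),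
        ∑ i ∈ Finset.range N, inner ℂ (h i) ((T ^ n) (h (i + n))) -
        ∑ i ∈ Finset.range N, inner ℂ (h i) (h i)) := by
    simp_rw [e1]
    rw [Finset.sum_comm, Finset.mul_sum]
    refine Finset.sum_congr rfl fun m hm => ?_
    rw [Finset.mem_range] at hm
    rw [Finset.sum_sub_distrib, ← Finset.mul_sum, Finset.sum_comm, mul_sub,
      sum_rootsOfUnity_inner hζ (by omega) 1 h hsupp, mul_left_comm,
      Finset.mul_sum (Finset.range (m + 1)) _ (K : ℂ)]
    congr 2
    refine Finset.sum_congr rfl fun n hn => ?_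
    rw [Finset.mem_range] at hn
    exact sum_rootsOfUnity_inner hζ (by omega) (T ^ n) h hsupp
  rw [← Complex.re_sum, e2]
  have e3 : ∑ i ∈ Finset.range N, inner ℂ (h i) (h i) =
      ((∑ i ∈ Finset.range N, ‖h i‖ ^ 2 : ℝ) : ℂ) := by
    push_cast
    exact Finset.sum_congr rfl fun i _ => inner_self_eq_norm_sq_to_K _
  rw [e3, ← Complex.ofReal_natCast, Complex.re_ofReal_mul, Complex.re_sum]
  congr 1
  refine Finset.sum_congr rfl fun m _ => ?_
  rw [toeplitzForm, Complex.sub_re, Complex.ofReal_re, ← Complex.re_sum]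
  congr 1
  rw [show (2 : ℂ) = ((2 : ℝ) : ℂ) by simp, Complex.re_ofReal_mul]

/-- The Fejér inequalities, tested on the discrete Fourier transforms of `h` and summed over the
roots of unity, bound the sums of partial Toeplitz forms. -/
theorem toeplitzForm_le {T T' : H →L[ℂ] H} {c : ℝ}
    (hc : ∀ p : Polynomial ℂ, (∀ z : ℂ, ‖z‖ ≤ 1 → 0 ≤ (p.eval z).re) → ∀ x,
      (inner ℂ x (Polynomial.aeval T p x)).re ≤ c * (inner ℂ x (Polynomial.aeval T' p x)).re)
    {N : ℕ} (h : ℕ → H) (hsupp : ∀ j, N ≤ j → h j = 0) :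
    toeplitzForm T N h N ≤ c * toeplitzForm T' N h N := by
  have hsum : ∀ M : ℕ, ∑ m ∈ Finset.range M, toeplitzForm T N h m ≤
      c * ∑ m ∈ Finset.range M, toeplitzForm T' N h m := by
    intro M
    set K := N + M + 1 with hK
    have hζ := Complex.isPrimitiveRoot_exp K (by omega)
    set ζ := Complex.exp (2 * Real.pi * Complex.I / K)
    have hnorm : ‖ζ‖ = 1 := hζ.norm'_eq_one (by omega)
    have hKpos : (0 : ℝ) < K := by positivity
    have h1 := sum_rootsOfUnity_fejerPoly hζ (by omega : N + M < K) T h hsupp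
    have h2 := sum_rootsOfUnity_fejerPoly hζ (by omega : N + M < K) T' h hsupp
    have h3 := Finset.sum_le_sum fun k (_ : k ∈ Finset.range K) =>
      hc (fejerPoly ((ζ ^ k)⁻¹) M)
        (fun z hz => fejerPoly_eval_re_nonneg (by simp [hnorm]) hz M)
        (∑ i ∈ Finset.range N, ζ ^ (k * i) • h i)
    rw [← Finset.mul_sum, h1, h2, mul_left_comm] at h3
    exact le_of_mul_le_mul_left h3 hKpos
  -- The partial forms are constant from index N on, so their Cesàro means converge to that
  -- constant.
  have hlim : ∀ A : H →L[ℂ] H, Tendsto (fun M : ℕ => (M : ℝ)⁻¹ *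
      ∑ m ∈ Finset.range M, toeplitzForm A N h m) atTop (𝓝 (toeplitzForm A N h N)) := fun A =>
    Filter.Tendsto.cesaro (tendsto_const_nhds.congr'
      (eventually_atTop.2 ⟨N, fun m hm => (toeplitzForm_of_le A hm h hsupp).symm⟩))
  refine le_of_tendsto_of_tendsto' (hlim T) ((hlim T').const_mul c) fun M => ?_
  rw [mul_left_comm]
  exact mul_le_mul_of_nonneg_left (hsum M) (by positivity)

/-- If `s i = h i + T (s (i+1))`, the Toeplitz form telescopes. -/
theorem toeplitzForm_eq (T : H →L[ℂ] H) {N : ℕ} (h s : ℕ → H)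
    (hs0 : ∀ j, N ≤ j → s j = 0) (hs : ∀ i, s i = h i + T (s (i + 1))) :
    toeplitzForm T N h N = ∑ i ∈ Finset.range N, (‖s i‖ ^ 2 - ‖T (s (i + 1))‖ ^ 2) := by
  have hsum : ∀ m i, s i = ∑ n ∈ Finset.range m, (T ^ n) (h (i + n)) + (T ^ m) (s (i + m)) := by
    intro m
    induction m with
    | zero => intro i; simp
    | succ m ih =>
      intro i
      rw [Finset.sum_range_succ, add_assoc, ih i, hs (i + m), map_add, pow_succ]
      rfl
  have hsN : ∀ i, s i = ∑ n ∈ Finset.range (N + 1), (T ^ n) (h (i + n)) := by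
    intro i
    rw [hsum (N + 1) i, hs0 _ (by omega), map_zero, add_zero]
  rw [toeplitzForm, ← Complex.re_sum, Finset.sum_comm]
  simp_rw [← inner_sum, ← hsN]
  rw [Complex.re_sum, Finset.mul_sum, ← Finset.sum_sub_distrib]
  refine Finset.sum_congr rfl fun i _ => ?_
  -- The summand is 2 Re⟨hᵢ, sᵢ⟩ - ‖hᵢ‖² = ‖sᵢ‖² - ‖sᵢ - hᵢ‖².
  have : T (s (i + 1)) = s i - h i := by rw [hs i]; abel
  have hre : RCLike.re (inner ℂ (s i) (h i)) = (inner ℂ (h i) (s i)).re :=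
    inner_re_symm (𝕜 := ℂ) (s i) (h i)
  rw [this, @norm_sub_sq ℂ, hre]
  ring

/-- With hᵢ = fᵢ - T'fᵢ₊₁, the recursion for T' is solved by f itself, which produces the right
side. The solution s for T starts with s₀ equal to the sum on the left, and contractivity of T lets
every other term be discarded. -/
theorem norm_sum_pow_sub_le {T T' : H →L[ℂ] H} {c : ℝ} (hT : ‖T‖ ≤ 1)
    (hc : ∀ p : Polynomial ℂ, (∀ z : ℂ, ‖z‖ ≤ 1 → 0 ≤ (p.eval z).re) → ∀ x,
      (inner ℂ x (Polynomial.aeval T p x)).re ≤ c * (inner ℂ x (Polynomial.aeval T' p x)).re)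
    (N : ℕ) (g : ℕ → H) :
    ‖∑ n ∈ Finset.range N, (T ^ n) ((T - T') (g n))‖ ^ 2 ≤
      c * ∑ n ∈ Finset.range N, (‖g n‖ ^ 2 - ‖T' (g n)‖ ^ 2) := by
  -- The sequence g is shifted by one: f₀ = 0 removes the unwanted boundary term from s₀ and from
  -- the telescoped sum.
  set f : ℕ → H := fun i => if i = 0 then 0 else if i ≤ N then g (i - 1) else 0 with hf
  have hf0 : f 0 = 0 := by simp [hf]
  have hfs : ∀ i, i < N → f (i + 1) = g i := fun i hi => by
    simp [hf, Nat.succ_le_iff.2 hi]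
  have hfN : ∀ j, N + 1 ≤ j → f j = 0 := fun j hj => by
    simp only [hf]; rw [if_neg (by omega), if_neg (by omega)]
  set h : ℕ → H := fun i => f i - T' (f (i + 1)) with hh
  have hhN : ∀ j, N + 1 ≤ j → h j = 0 := fun j hj => by
    simp [hh, hfN j hj, hfN (j + 1) (by omega)]
  set s : ℕ → H := fun i => ∑ n ∈ Finset.range (N + 1 - i), (T ^ n) (h (i + n)) with hs
  have h1 := toeplitzForm_le hc h hhN
  rw [toeplitzForm_eq T' h f hfN (fun i => by simp [hh]),
    toeplitzForm_eq T h s (fun j hj => by simp [hs, Nat.sub_eq_zero_of_le hj]) ?_] at h1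
  · have hle : ∀ x, ‖T x‖ ≤ ‖x‖ := fun x => by simpa using T.le_of_opNorm_le hT x
    have hsN : s (N + 1) = 0 := by simp [hs]
    have h2 : ‖s 0‖ ^ 2 ≤ ∑ i ∈ Finset.range (N + 1), (‖s i‖ ^ 2 - ‖T (s (i + 1))‖ ^ 2) := by
      rw [Finset.sum_sub_distrib, Finset.sum_range_succ', Finset.sum_range_succ
        (fun i => ‖T (s (i + 1))‖ ^ 2), hsN]
      have : ∑ i ∈ Finset.range N, ‖T (s (i + 1))‖ ^ 2 ≤
          ∑ i ∈ Finset.range N, ‖s (i + 1)‖ ^ 2 :=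
        Finset.sum_le_sum fun i _ => by have := hle (s (i + 1)); gcongr
      simp only [map_zero, norm_zero]
      linarith
    have h3 : ∑ i ∈ Finset.range (N + 1), (‖f i‖ ^ 2 - ‖T' (f (i + 1))‖ ^ 2) =
        ∑ n ∈ Finset.range N, (‖g n‖ ^ 2 - ‖T' (g n)‖ ^ 2) := by
      rw [Finset.sum_sub_distrib, Finset.sum_range_succ', Finset.sum_range_succ
        (fun i => ‖T' (f (i + 1))‖ ^ 2), hfN (N + 1) le_rfl, hf0, Finset.sum_sub_distrib]
      simp only [map_zero, norm_zero]
      have e1 : ∑ i ∈ Finset.range N, ‖f (i + 1)‖ ^ 2 = ∑ i ∈ Finset.range N, ‖g i‖ ^ 2 :=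
        Finset.sum_congr rfl fun i hi => by rw [hfs i (Finset.mem_range.1 hi)]
      have e2 : ∑ i ∈ Finset.range N, ‖T' (f (i + 1))‖ ^ 2 =
          ∑ i ∈ Finset.range N, ‖T' (g i)‖ ^ 2 :=
        Finset.sum_congr rfl fun i hi => by rw [hfs i (Finset.mem_range.1 hi)]
      rw [e1, e2]
      simp
    have h4 : s 0 = ∑ n ∈ Finset.range N, (T ^ n) ((T - T') (g n)) := by
      simp only [hs, hh, Nat.sub_zero, zero_add, map_sub, Finset.sum_sub_distrib]
      rw [Finset.sum_range_succ', Finset.sum_range_succ (fun n => (T ^ n) (T' (f (n + 1)))), hf0,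
        hfN (N + 1) le_rfl]
      simp only [map_zero, add_zero]
      rw [← Finset.sum_sub_distrib]
      refine Finset.sum_congr rfl fun i hi => ?_
      rw [hfs i (Finset.mem_range.1 hi), pow_succ]
      simp
    rw [← h4]
    rw [h3] at h1
    exact h2.trans h1
  · intro i
    simp only [hs]
    rcases le_or_gt i N with hi | hi
    · obtain ⟨k, rfl⟩ := Nat.exists_eq_add_of_le hi
      rw [show i + k + 1 - i = k + 1 by omega, show i + k + 1 - (i + 1) = k by omega,
        Finset.sum_range_succ', map_sum, add_comm]
      congr 1
      · refine Finset.sum_congr rfl fun n _ => ?_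
        rw [pow_succ', show i + (n + 1) = i + 1 + n by omega]; rfl
    · rw [Nat.sub_eq_zero_of_le (by omega), Nat.sub_eq_zero_of_le (by omega), hhN i hi]
      simp

end Toeplitz

/-! ### The asymptotic limit and its quadratic form. -/

section AsymptoticLimit

variable {H : Type*} [NormedAddCommGroup H] [InnerProductSpace ℂ H]

theorem norm_apply_le_of_contraction {T : H →L[ℂ] H} (hT : ‖T‖ ≤ 1) (x : H) : ‖T x‖ ≤ ‖x‖ := by
  simpa using T.le_of_opNorm_le hT x

theorem norm_pow_apply_le_of_contraction {T : H →L[ℂ] H} (hT : ‖T‖ ≤ 1) (n : ℕ) (x : H) :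
    ‖(T ^ n) x‖ ≤ ‖x‖ := by
  induction n with
  | zero => simp
  | succ n ih =>
    rw [pow_succ']
    exact (norm_apply_le_of_contraction hT _).trans ih

variable [CompleteSpace H]

theorem inner_adjoint_pow_mul_pow (T : H →L[ℂ] H) (n : ℕ) (x y : H) :
    inner ℂ ((ContinuousLinearMap.adjoint T ^ n * T ^ n) x) y =
      inner ℂ ((T ^ n) x) ((T ^ n) y) := by
  have : ContinuousLinearMap.adjoint T ^ n = ContinuousLinearMap.adjoint (T ^ n) := by
    rw [← ContinuousLinearMap.star_eq_adjoint, ← ContinuousLinearMap.star_eq_adjoint, star_pow]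
  rw [this]
  exact ContinuousLinearMap.adjoint_inner_left (T ^ n) y ((T ^ n) x)

theorem tendsto_inner_pow_apply {T : H →L[ℂ] H} (hT : ‖T‖ ≤ 1) (x y : H) :
    Tendsto (fun n : ℕ => inner ℂ ((T ^ n) x) ((T ^ n) y)) atTop
      (𝓝 (inner ℂ (asymptoticLimit T x) y)) := by
  simpa only [inner_adjoint_pow_mul_pow] using
    (tendsto_asymptoticLimit T hT x).inner (𝕜 := ℂ) (tendsto_const_nhds (x := y))

theorem inner_asymptoticLimit_symm {T : H →L[ℂ] H} (hT : ‖T‖ ≤ 1) (x y : H) :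
    inner ℂ (asymptoticLimit T x) y = inner ℂ x (asymptoticLimit T y) := by
  rw [← inner_conj_symm x]
  refine tendsto_nhds_unique (tendsto_inner_pow_apply hT x y) ?_
  simpa only [Function.comp_def, inner_conj_symm] using
    (Complex.continuous_conj.tendsto _).comp (tendsto_inner_pow_apply hT y x)

/-- The quadratic form `⟨S_T x, x⟩ = lim ‖Tⁿ x‖²` of the asymptotic limit. -/
noncomputable def asymptoticForm (T : H →L[ℂ] H) (x : H) : ℝ :=
  (inner ℂ (asymptoticLimit T x) x).re

theorem tendsto_norm_pow_apply_sq {T : H →L[ℂ] H} (hT : ‖T‖ ≤ 1) (x : H) :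
    Tendsto (fun n : ℕ => ‖(T ^ n) x‖ ^ 2) atTop (𝓝 (asymptoticForm T x)) := by
  have h := (Complex.continuous_re.tendsto _).comp (tendsto_inner_pow_apply hT x x)
  refine h.congr fun n => ?_
  exact inner_self_eq_norm_sq (𝕜 := ℂ) _

theorem asymptoticForm_nonneg {T : H →L[ℂ] H} (hT : ‖T‖ ≤ 1) (x : H) : 0 ≤ asymptoticForm T x :=
  ge_of_tendsto' (tendsto_norm_pow_apply_sq hT x) fun _ => sq_nonneg _

theorem asymptoticForm_le {T : H →L[ℂ] H} (hT : ‖T‖ ≤ 1) (x : H) :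
    asymptoticForm T x ≤ ‖x‖ ^ 2 :=
  le_of_tendsto' (tendsto_norm_pow_apply_sq hT x) fun n => by
    have := norm_pow_apply_le_of_contraction hT n x
    gcongr

theorem asymptoticForm_apply {T : H →L[ℂ] H} (hT : ‖T‖ ≤ 1) (x : H) :
    asymptoticForm T (T x) = asymptoticForm T x := by
  refine tendsto_nhds_unique (tendsto_norm_pow_apply_sq hT (T x)) ?_
  refine ((tendsto_add_atTop_iff_nat 1).2 (tendsto_norm_pow_apply_sq hT x)).congr fun n => ?_
  rw [pow_succ]; rfl

theorem mem_nullSpaceAL_iff {T : H →L[ℂ] H} (hT : ‖T‖ ≤ 1) {x : H} :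
    x ∈ nullSpaceAL T ↔ Tendsto (fun n : ℕ => (T ^ n) x) atTop (𝓝 0) := by
  constructor
  · intro hx
    have h := tendsto_norm_pow_apply_sq hT x
    have hx' : asymptoticLimit T x = 0 := hx
    rw [asymptoticForm, hx', inner_zero_left, Complex.zero_re] at h
    rw [tendsto_zero_iff_norm_tendsto_zero]
    simpa using h.sqrt
  · intro hx
    have h : ∀ y, inner ℂ (asymptoticLimit T x) y = 0 := by
      intro y
      refine tendsto_nhds_unique (tendsto_inner_pow_apply hT x y) ?_
      refine squeeze_zero_norm (a := fun n : ℕ => ‖(T ^ n) x‖ * ‖y‖) (fun n => ?_) ?_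
      · refine (norm_inner_le_norm _ _).trans ?_
        gcongr
        exact norm_pow_apply_le_of_contraction hT n y
      · simpa using hx.norm.mul_const ‖y‖
    exact inner_self_eq_zero.1 (h _)

theorem apply_mem_nullSpaceAL {T A : H →L[ℂ] H} (hT : ‖T‖ ≤ 1) (hA : Commute A T) {x : H}
    (hx : x ∈ nullSpaceAL T) : A x ∈ nullSpaceAL T := by
  rw [mem_nullSpaceAL_iff hT] at hx ⊢
  have := (A.continuous.tendsto 0).comp hx
  rw [map_zero] at this
  refine this.congr fun n => ?_
  exact congrArg (fun B : H →L[ℂ] H => B x) (hA.pow_right n).eq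

theorem asymptoticForm_eq_of_sub_mem {T : H →L[ℂ] H} (hT : ‖T‖ ≤ 1) {x y : H}
    (h : x - y ∈ nullSpaceAL T) : asymptoticForm T x = asymptoticForm T y := by
  have h' : asymptoticLimit T (x - y) = 0 := h
  have hS : asymptoticLimit T x = asymptoticLimit T y := by rwa [map_sub, sub_eq_zero] at h'
  have e : inner ℂ (asymptoticLimit T x) x = inner ℂ (asymptoticLimit T y) y := by
    rw [inner_asymptoticLimit_symm hT, hS, ← inner_asymptoticLimit_symm hT, hS]
  rw [asymptoticForm, e, asymptoticForm]

/-- The form is T-invariant and descends to the quotient by N(S_T), on which T and T' agree. -/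
theorem asymptoticForm_pow_apply {T T' : H →L[ℂ] H} (hT : ‖T‖ ≤ 1)
    (h : ∀ x, T x - T' x ∈ nullSpaceAL T) (n : ℕ) (x : H) :
    asymptoticForm T ((T' ^ n) x) = asymptoticForm T x := by
  induction n with
  | zero => simp
  | succ n ih =>
    rw [pow_succ']
    change asymptoticForm T (T' ((T' ^ n) x)) = _
    rw [← asymptoticForm_eq_of_sub_mem hT (h _), asymptoticForm_apply hT, ih]

theorem closedRangeAL_eq_orthogonal {T : H →L[ℂ] H} (hT : ‖T‖ ≤ 1) :
    closedRangeAL T = (nullSpaceAL T)ᗮ := by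
  have hadj : ContinuousLinearMap.adjoint (asymptoticLimit T) = asymptoticLimit T :=
    ((ContinuousLinearMap.eq_adjoint_iff _ _).2 (inner_asymptoticLimit_symm hT)).symm
  have h := (asymptoticLimit T).orthogonal_ker
  rw [hadj] at h
  exact h.symm

theorem mem_nullSpaceAL_of_asymptoticForm_nonpos {T : H →L[ℂ] H} (hT : ‖T‖ ≤ 1) {x : H}
    (h : asymptoticForm T x ≤ 0) : x ∈ nullSpaceAL T := by
  rw [mem_nullSpaceAL_iff hT, tendsto_zero_iff_norm_tendsto_zero]
  have h2 := tendsto_norm_pow_apply_sq hT x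
  rw [le_antisymm h (asymptoticForm_nonneg hT x)] at h2
  simpa using h2.sqrt

/-- By invariance, the form of T at x is at most ‖T'ⁿx‖² for every n. -/
theorem nullSpaceAL_le_of_sub_mem {T T' : H →L[ℂ] H} (hT : ‖T‖ ≤ 1) (hT' : ‖T'‖ ≤ 1)
    (h : ∀ x, T x - T' x ∈ nullSpaceAL T) : nullSpaceAL T' ≤ nullSpaceAL T := by
  intro x hx
  rw [mem_nullSpaceAL_iff hT'] at hx
  refine mem_nullSpaceAL_of_asymptoticForm_nonpos hT ?_
  have h2 : Tendsto (fun n : ℕ => ‖(T' ^ n) x‖ ^ 2) atTop (𝓝 0) := by simpa using hx.norm.pow 2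
  refine ge_of_tendsto' h2 fun n => ?_
  rw [← asymptoticForm_pow_apply hT h n x]
  exact asymptoticForm_le hT _

/-! ### Equality of the null spaces. -/

section Harnack

variable {T T' : H →L[ℂ] H}

theorem sub_apply_mem_nullSpaceAL_right (hT : ‖T‖ ≤ 1) (hT' : ‖T'‖ ≤ 1)
    (hcomm : T * T' = T' * T) (hdom : HarnackDominated T T') (x : H) :
    T x - T' x ∈ nullSpaceAL T' := by
  obtain ⟨c, hc1, hc⟩ := harnackDominated_iff.1 hdom
  rw [mem_nullSpaceAL_iff hT', tendsto_zero_iff_norm_tendsto_zero]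
  have h1 := tendsto_norm_pow_apply_sq hT' x
  have h2 := (h1.sub ((tendsto_add_atTop_iff_nat 1).2 h1)).const_mul c
  rw [sub_self, mul_zero] at h2
  have h3 : Tendsto (fun n : ℕ => ‖(T' ^ n) (T x - T' x)‖ ^ 2) atTop (𝓝 0) := by
    refine squeeze_zero (fun n => sq_nonneg _) (fun n => ?_) h2
    -- One term suffices: the bound is a difference of consecutive terms of the convergent sequence
    -- ‖T'ⁿx‖².
    have h4 := norm_sum_pow_sub_le hT hc 1 (fun _ => (T' ^ n) x)
    have hA : Commute (T - T') (T' ^ n) :=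
      Commute.pow_right (Commute.sub_left hcomm (Commute.refl T')) n
    have e1 : (T' ^ n) (T x - T' x) = (T - T') ((T' ^ n) x) :=
      (congrArg (fun B : H →L[ℂ] H => B x) hA.eq).symm
    have e2 : (T' ^ (n + 1)) x = T' ((T' ^ n) x) := by rw [pow_succ']; rfl
    rw [e1, e2]
    simpa using h4
  simpa using h3.sqrt

theorem sub_apply_mem_nullSpaceAL_left (hT : ‖T‖ ≤ 1)
    (hcomm : T * T' = T' * T) (hdom : HarnackDominated T T') (x : H) :
    T x - T' x ∈ nullSpaceAL T := by
  obtain ⟨c, hc1, hc⟩ := harnackDominated_iff.1 hdom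
  rw [mem_nullSpaceAL_iff hT, tendsto_zero_iff_norm_tendsto_zero]
  have hA : ∀ k, Commute (T - T') (T ^ k) := fun k =>
    Commute.pow_right (Commute.sub_left (Commute.refl T) hcomm.symm) k
  have h3 : Tendsto (fun n : ℕ => ‖(T ^ n) (T x - T' x)‖ ^ 2) atTop (𝓝 0) := by
    refine squeeze_zero (g := fun n : ℕ => c * ‖x‖ ^ 2 * (1 / ((n : ℝ) + 1)))
      (fun n => sq_nonneg _) (fun n => ?_)
      (by simpa using (tendsto_one_div_add_atTop_nhds_zero_nat (𝕜 := ℝ)).const_mul (c * ‖x‖ ^ 2))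
    -- This choice makes all n + 1 summands equal to Tⁿ(T - T')x, so the left side carries (n+1)²
    -- while the right side grows only linearly.
    have h4 := norm_sum_pow_sub_le hT hc (n + 1) (fun k => (T ^ (n - k)) x)
    have e1 : ∀ k ∈ Finset.range (n + 1),
        (T ^ k) ((T - T') ((T ^ (n - k)) x)) = (T ^ n) (T x - T' x) := by
      intro k hk
      rw [Finset.mem_range] at hk
      have e2 : (T - T') ((T ^ (n - k)) x) = (T ^ (n - k)) (T x - T' x) :=
        congrArg (fun B : H →L[ℂ] H => B x) (hA (n - k)).eq
      rw [e2]
      change (T ^ k * T ^ (n - k)) _ = _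
      rw [← pow_add, Nat.add_sub_of_le (by omega)]
    rw [Finset.sum_congr rfl e1, Finset.sum_const, Finset.card_range, ← Nat.cast_smul_eq_nsmul ℂ,
      norm_smul, mul_pow, Complex.norm_natCast] at h4
    have h5 : ∑ k ∈ Finset.range (n + 1), (‖(T ^ (n - k)) x‖ ^ 2 - ‖T' ((T ^ (n - k)) x)‖ ^ 2) ≤
        (n + 1) * ‖x‖ ^ 2 := by
      have : ∀ k ∈ Finset.range (n + 1),
          ‖(T ^ (n - k)) x‖ ^ 2 - ‖T' ((T ^ (n - k)) x)‖ ^ 2 ≤ ‖x‖ ^ 2 := fun k _ => by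
        have h6 : ‖(T ^ (n - k)) x‖ ^ 2 ≤ ‖x‖ ^ 2 := by
          have := norm_pow_apply_le_of_contraction hT (n - k) x
          gcongr
        linarith [sq_nonneg ‖T' ((T ^ (n - k)) x)‖]
      simpa using Finset.sum_le_sum this
    have h7 := h4.trans (mul_le_mul_of_nonneg_left h5 (by linarith))
    have hn : (0 : ℝ) < n + 1 := by positivity
    rw [Nat.cast_add_one] at h7
    rw [mul_one_div, le_div_iff₀ hn]
    refine le_of_mul_le_mul_left (a := (n : ℝ) + 1) ?_ hn
    linarith
  simpa using h3.sqrt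

theorem nullSpaceAL_eq_of_harnackDominated (hT : ‖T‖ ≤ 1) (hT' : ‖T'‖ ≤ 1)
    (hcomm : T * T' = T' * T) (hdom : HarnackDominated T T') :
    nullSpaceAL T = nullSpaceAL T' := by
  refine le_antisymm (nullSpaceAL_le_of_sub_mem hT' hT fun x => ?_)
    (nullSpaceAL_le_of_sub_mem hT hT' (sub_apply_mem_nullSpaceAL_left hT hcomm hdom))
  rw [← neg_sub]
  exact neg_mem (sub_apply_mem_nullSpaceAL_right hT hT' hcomm hdom x)

end Harnack

/-! ### The case of an idempotent asymptotic limit. -/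

section Idempotent

variable {T T' : H →L[ℂ] H}

/-- Since S = S_T is a contraction, ‖Sy - y‖² = ‖Sy‖² - 2⟨Sy, y⟩ + ‖y‖² ≤ 0. -/
theorem asymptoticLimit_apply_of_asymptoticForm_ge (hT : ‖T‖ ≤ 1) {y : H}
    (hy : ‖y‖ ^ 2 ≤ asymptoticForm T y) : asymptoticLimit T y = y := by
  have hle : ‖asymptoticLimit T y‖ ≤ ‖y‖ := by
    by_cases h0 : asymptoticLimit T y = 0
    · simp [h0]
    refine le_of_mul_le_mul_right (a := ‖asymptoticLimit T y‖) ?_ (norm_pos_iff.2 h0)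
    have h1 : Tendsto (fun n : ℕ => ‖(inner ℂ ((T ^ n) y) ((T ^ n) (asymptoticLimit T y)) : ℂ)‖)
        atTop (𝓝 _) := (tendsto_inner_pow_apply hT y (asymptoticLimit T y)).norm
    rw [inner_self_eq_norm_sq_to_K] at h1
    have h2 := le_of_tendsto' h1 (b := ‖y‖ * ‖asymptoticLimit T y‖) fun n =>
      (norm_inner_le_norm _ _).trans (mul_le_mul (norm_pow_apply_le_of_contraction hT n _)
        (norm_pow_apply_le_of_contraction hT n _) (norm_nonneg _) (norm_nonneg _))
    simpa [pow_two] using h2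
  have h3 : ‖asymptoticLimit T y - y‖ ^ 2 ≤ 0 := by
    have h4 : RCLike.re (inner ℂ (asymptoticLimit T y) y) = asymptoticForm T y := rfl
    have h5 : ‖asymptoticLimit T y‖ ^ 2 ≤ ‖y‖ ^ 2 := by gcongr
    rw [@norm_sub_sq ℂ, h4]
    linarith
  rw [← sub_eq_zero, ← norm_eq_zero]
  exact pow_eq_zero_iff two_ne_zero |>.1 (le_antisymm h3 (sq_nonneg _))

theorem asymptoticLimit_apply_of_mem_closedRangeAL
    (hS : asymptoticLimit T = asymptoticLimit T ^ 2) {y : H} (hy : y ∈ closedRangeAL T) :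
    asymptoticLimit T y = y := by
  have hclosed : IsClosed {y | asymptoticLimit T y = y} :=
    isClosed_eq (asymptoticLimit T).continuous continuous_id
  refine hclosed.closure_subset_iff.2 ?_ hy
  rintro _ ⟨x, rfl⟩
  exact (congrArg (fun B : H →L[ℂ] H => B x) (hS.trans (pow_two _))).symm

theorem asymptoticForm_of_mem_closedRangeAL
    (hS : asymptoticLimit T = asymptoticLimit T ^ 2) {y : H} (hy : y ∈ closedRangeAL T) :
    asymptoticForm T y = ‖y‖ ^ 2 := by
  rw [asymptoticForm, asymptoticLimit_apply_of_mem_closedRangeAL hS hy]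
  exact inner_self_eq_norm_sq (𝕜 := ℂ) _

theorem isCompl_nullSpaceAL_closedRangeAL (hT : ‖T‖ ≤ 1) :
    IsCompl (nullSpaceAL T) (closedRangeAL T) := by
  rw [closedRangeAL_eq_orthogonal hT]
  exact Submodule.isCompl_orthogonal _

/-- Both limits vanish on N(S_T). For l in the closed range, ‖l‖² is the T-form of T'ⁿl, hence at
most ‖T'ⁿl‖², so S_T' fixes l. -/
theorem asymptoticLimit_eq_of_idempotent (hT : ‖T‖ ≤ 1) (hT' : ‖T'‖ ≤ 1)
    (hnull : nullSpaceAL T = nullSpaceAL T') (hsub : ∀ x, T x - T' x ∈ nullSpaceAL T)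
    (hS : asymptoticLimit T = asymptoticLimit T ^ 2) :
    asymptoticLimit T = asymptoticLimit T' := by
  ext x
  obtain ⟨m, hm, l, hl, rfl⟩ := Submodule.mem_sup.1
    ((isCompl_nullSpaceAL_closedRangeAL hT).sup_eq_top ▸ Submodule.mem_top : x ∈ _ ⊔ _)
  have hm1 : asymptoticLimit T m = 0 := hm
  have hm2 : asymptoticLimit T' m = 0 := by
    rw [hnull] at hm; exact hm
  rw [map_add, map_add, hm1, hm2, asymptoticLimit_apply_of_mem_closedRangeAL hS hl,
    asymptoticLimit_apply_of_asymptoticForm_ge hT']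
  refine ge_of_tendsto' (tendsto_norm_pow_apply_sq hT' l) fun n => ?_
  rw [← asymptoticForm_of_mem_closedRangeAL hS hl, ← asymptoticForm_pow_apply hT hsub n l]
  exact asymptoticForm_le hT _

theorem apply_mem_closedRangeAL_of_idempotent (hT : ‖T‖ ≤ 1)
    (hS : asymptoticLimit T = asymptoticLimit T ^ 2) {y : H} (hy : y ∈ closedRangeAL T) :
    T y ∈ closedRangeAL T ∧ ‖T y‖ = ‖y‖ := by
  have h1 : asymptoticForm T (T y) = ‖y‖ ^ 2 := by
    rw [asymptoticForm_apply hT, asymptoticForm_of_mem_closedRangeAL hS hy]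
  have h2 := norm_apply_le_of_contraction hT y
  have h3 : asymptoticLimit T (T y) = T y := by
    apply asymptoticLimit_apply_of_asymptoticForm_ge hT
    rw [h1]
    gcongr
  refine ⟨Submodule.le_topologicalClosure _ ⟨T y, h3⟩, le_antisymm h2 ?_⟩
  have h4 := asymptoticForm_le hT (T y)
  rw [h1] at h4
  exact le_of_sq_le_sq h4 (norm_nonneg _)

end Idempotent

end AsymptoticLimit

/-! ### Blocks of an operator and restriction to invariant subspaces. -/

section Blocks

variable {H : Type*} [NormedAddCommGroup H] [InnerProductSpace ℂ H]

/-- The block `P_M T|_L` of `T`. -/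
noncomputable def compressionBlock (T : H →L[ℂ] H) (M L : Submodule ℂ H)
    [M.HasOrthogonalProjection] : L →L[ℂ] M :=
  M.orthogonalProjectionOnto ∘L T ∘L L.subtypeL

theorem compressionBlock_eq_of_sub_mem {T T' : H →L[ℂ] H} {M L : Submodule ℂ H}
    [L.HasOrthogonalProjection] (hL : L = Mᗮ)
    (h : ∀ x, T x - T' x ∈ M) : compressionBlock T L L = compressionBlock T' L L := by
  ext1 y
  change L.orthogonalProjectionOnto (T y) = L.orthogonalProjectionOnto (T' y)
  rw [← sub_eq_zero, ← map_sub, Submodule.orthogonalProjectionOnto_eq_zero_iff]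
  have hM : M ≤ Lᗮ := by rw [hL]; exact M.le_orthogonal_orthogonal
  exact hM (h y)

variable {T : H →L[ℂ] H} {M L : Submodule ℂ H} [M.HasOrthogonalProjection]

theorem compressionBlock_apply (y : L) :
    compressionBlock T M L y = M.orthogonalProjectionOnto (T y) := rfl

theorem coe_compressionBlock_of_mem {y : L} (h : T y ∈ M) :
    (compressionBlock T M L y : H) = T y := by
  rw [compressionBlock_apply]
  exact congrArg Subtype.val (Submodule.orthogonalProjectionOnto_mem_subspace_eq_self ⟨T y, h⟩)

theorem compressionBlock_add_compressionBlock [L.HasOrthogonalProjection] (hL : L = Mᗮ) (y : L) :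
    (compressionBlock T M L y : H) + (compressionBlock T L L y : H) = T y := by
  subst hL
  exact M.starProjection_add_starProjection_orthogonal (T y)

end Blocks

section Intertwining

variable {E F : Type*} [NormedAddCommGroup E] [NormedSpace ℂ E] [NormedAddCommGroup F]
  [NormedSpace ℂ F]

theorem map_pow_apply_of_intertwines {X : E →L[ℂ] F} {A : E →L[ℂ] E} {B : F →L[ℂ] F}
    (h : ∀ x, X (A x) = B (X x)) (n : ℕ) (x : E) : X ((A ^ n) x) = (B ^ n) (X x) := by
  induction n with
  | zero => simp
  | succ n ih =>
    rw [pow_succ', pow_succ']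
    change X (A ((A ^ n) x)) = B ((B ^ n) (X x))
    rw [h, ih]

theorem map_aeval_apply_of_intertwines {X : E →L[ℂ] F} {A : E →L[ℂ] E} {B : F →L[ℂ] F}
    (h : ∀ x, X (A x) = B (X x)) (p : Polynomial ℂ) (x : E) :
    X (Polynomial.aeval A p x) = Polynomial.aeval B p (X x) := by
  induction p using Polynomial.induction_on' with
  | add p q hp hq => simp only [map_add, add_apply, hp, hq]
  | monomial n a =>
    simp only [Polynomial.aeval_monomial, Algebra.algebraMap_eq_smul_one, smul_mul_assoc, one_mul,
      smul_apply, map_smul, map_pow_apply_of_intertwines h]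

end Intertwining

/-! ### Harnack domination and orthogonal sums. -/

section HarnackBlocks

variable {H : Type*} [NormedAddCommGroup H] [InnerProductSpace ℂ H]
  {T T' : H →L[ℂ] H} {M L : Submodule ℂ H}

theorem inner_aeval_restrict {Q : M →L[ℂ] M} (hQ : ∀ x, (Q x : H) = T x) (p : Polynomial ℂ)
    (x : M) : inner ℂ x (Polynomial.aeval Q p x) =
      inner ℂ (x : H) (Polynomial.aeval T p (x : H)) := by
  rw [Submodule.coe_inner]
  exact congrArg _ (map_aeval_apply_of_intertwines (X := M.subtypeL) hQ p x)

theorem HarnackDominated.restrict [CompleteSpace H] [CompleteSpace M]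
    (h : HarnackDominated T T')
    {Q Q' : M →L[ℂ] M} (hQ : ∀ x, (Q x : H) = T x) (hQ' : ∀ x, (Q' x : H) = T' x) :
    HarnackDominated Q Q' := by
  rw [harnackDominated_iff] at h ⊢
  obtain ⟨c, hc1, hc⟩ := h
  refine ⟨c, hc1, fun p hp x => ?_⟩
  rw [inner_aeval_restrict hQ, inner_aeval_restrict hQ']
  exact hc p hp x

theorem inner_aeval_add {Q : M →L[ℂ] M} {W : L →L[ℂ] L} (hQ : ∀ x, (Q x : H) = T x)
    (hW : ∀ y, (W y : H) = T y) (hML : M ⟂ L) (p : Polynomial ℂ) (x : M) (y : L) :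
    inner ℂ (x + y : H) (Polynomial.aeval T p (x + y : H)) =
      inner ℂ x (Polynomial.aeval Q p x) + inner ℂ y (Polynomial.aeval W p y) := by
  have h1 : Polynomial.aeval T p (x : H) = (Polynomial.aeval Q p x : M) :=
    (map_aeval_apply_of_intertwines (X := M.subtypeL) hQ p x).symm
  have h2 : Polynomial.aeval T p (y : H) = (Polynomial.aeval W p y : L) :=
    (map_aeval_apply_of_intertwines (X := L.subtypeL) hW p y).symm
  rw [map_add, inner_add_left, inner_add_right, inner_add_right, h1, h2,
    hML.inner_eq (Submodule.coe_mem _) (Submodule.coe_mem _),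
    hML.symm.inner_eq (Submodule.coe_mem _) (Submodule.coe_mem _), add_zero, zero_add,
    Submodule.coe_inner, Submodule.coe_inner]

/-- Harnack domination with constant `1` is equality. -/
theorem eq_of_forall_inner_aeval_le
    (h : ∀ p : Polynomial ℂ, (∀ z : ℂ, ‖z‖ ≤ 1 → 0 ≤ (p.eval z).re) → ∀ x,
      (inner ℂ x (Polynomial.aeval T p x)).re ≤ (inner ℂ x (Polynomial.aeval T' p x)).re) :
    T = T' := by
  have key : ∀ w : ℂ, ‖w‖ ≤ 1 → ∀ x, (w * inner ℂ x ((T - T') x)).re ≤ 0 := by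
    intro w hw x
    -- The constant term contributes ‖x‖² on both sides and cancels; taking w = ±1, ±i then kills
    -- the whole form of T - T'.
    have h1 := h (1 + Polynomial.C w * Polynomial.X) (fun z hz => by
      have h2 : ‖w * z‖ ≤ 1 := by
        rw [norm_mul]; exact mul_le_one₀ hw (norm_nonneg _) hz
      have h3 := (abs_le.1 ((Complex.abs_re_le_norm (w * z)).trans h2)).1
      simp only [Polynomial.eval_add, Polynomial.eval_one, Polynomial.eval_mul, Polynomial.eval_C,
        Polynomial.eval_X, Complex.add_re, Complex.one_re]
      linarith) x
    simp only [map_add, map_one, map_mul, Polynomial.aeval_C, Polynomial.aeval_X,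
      Algebra.algebraMap_eq_smul_one, smul_mul_assoc, one_mul, add_apply, smul_apply,
      inner_add_right, inner_smul_right, Complex.add_re] at h1
    rw [sub_apply, inner_sub_right, mul_sub, Complex.sub_re]
    linarith
  rw [← sub_eq_zero]
  refine ContinuousLinearMap.coe_injective ((inner_map_self_eq_zero _).1 fun x => ?_)
  have hz : inner ℂ x ((T - T') x) = 0 := by
    have h1 := key 1 (by simp) x
    have h2 := key (-1) (by simp) x
    have h3 := key Complex.I (by simp) x
    have h4 := key (-Complex.I) (by simp) x
    simp only [one_mul, neg_mul, Complex.neg_re, Complex.I_mul_re] at h1 h2 h3 h4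
    apply Complex.ext <;> simp only [Complex.zero_re, Complex.zero_im] <;> linarith
  rw [← inner_conj_symm]
  exact (congrArg _ hz).trans (map_zero _)

/-- On L both operators are W, so only Re p(W) ≥ 0 is needed there. For c > 1 this follows from Re
p(W) ≤ c Re p(W); for c = 1 the operators are equal. -/
theorem HarnackDominated.symm_of_restrict [CompleteSpace H] [CompleteSpace M]
    (h : HarnackDominated T T')
    {Q Q' : M →L[ℂ] M} {W : L →L[ℂ] L} (hQ : ∀ x, (Q x : H) = T x)
    (hQ' : ∀ x, (Q' x : H) = T' x) (hW : ∀ y, (W y : H) = T y) (hW' : ∀ y, (W y : H) = T' y)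
    (hML : M ⟂ L) (hcompl : IsCompl M L) (hdom : HarnackDominated Q' Q) :
    HarnackDominated T' T := by
  obtain ⟨c, hc1, hc⟩ := harnackDominated_iff.1 h
  rcases hc1.eq_or_lt with rfl | hc1
  · have := eq_of_forall_inner_aeval_le (T := T) (T' := T') (by simpa using hc)
    rwa [this] at h ⊢
  obtain ⟨c', hc1', hc'⟩ := harnackDominated_iff.1 hdom
  refine harnackDominated_iff.2 ⟨c', hc1', fun p hp x => ?_⟩
  obtain ⟨m, hm, l, hl, rfl⟩ := Submodule.mem_sup.1
    (hcompl.sup_eq_top ▸ Submodule.mem_top : x ∈ M ⊔ L)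
  have h1 := inner_aeval_add hQ hW hML p ⟨m, hm⟩ ⟨l, hl⟩
  have h2 := inner_aeval_add hQ' hW' hML p ⟨m, hm⟩ ⟨l, hl⟩
  have h3 := hc' p hp ⟨m, hm⟩
  have h4 := hc p hp l
  have h5 := inner_aeval_restrict hW p ⟨l, hl⟩
  have h6 := inner_aeval_restrict hW' p ⟨l, hl⟩
  dsimp only at h1 h2 h5 h6
  rw [← h5, ← h6] at h4
  rw [h1, h2, Complex.add_re, Complex.add_re, mul_add]
  have h7 : 0 ≤ (inner ℂ (⟨l, hl⟩ : L) (Polynomial.aeval W p ⟨l, hl⟩)).re := by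
    by_contra! h8
    nlinarith
  have h9 := mul_nonneg (sub_nonneg.2 hc1') h7
  linarith

end HarnackBlocks

/-! ### Properties of the canonical triangulation. -/

section Triangulation

variable {H : Type*} [NormedAddCommGroup H] [InnerProductSpace ℂ H] [CompleteSpace H]
  {T T' : H →L[ℂ] H}

theorem isCanonicalTriangulation_compressionBlock {M L : Submodule ℂ H}
    [M.HasOrthogonalProjection] [L.HasOrthogonalProjection] (hT : ‖T‖ ≤ 1)
    (hM : M = nullSpaceAL T) (hL : L = closedRangeAL T) :
    IsCanonicalTriangulation T (compressionBlock T M M) (compressionBlock T M L)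
      (compressionBlock T L L) := by
  have hL' : L = Mᗮ := by rw [hL, closedRangeAL_eq_orthogonal hT, hM]
  refine ⟨hM, hL, ?_, ?_, fun x y => ?_⟩
  · rw [hL']; exact Submodule.isOrtho_orthogonal_right M
  · rw [hL']; exact M.isCompl_orthogonal
  · have hx : T x ∈ M := hM.ge (apply_mem_nullSpaceAL hT (Commute.refl T) (hM.le x.2))
    rw [map_add, Submodule.coe_add, add_assoc, compressionBlock_add_compressionBlock hL',
      coe_compressionBlock_of_mem hx]

variable {M L : Submodule ℂ H} {Q Q' : M →L[ℂ] M} {R R' : L →L[ℂ] M} {W : L →L[ℂ] L}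

namespace IsCanonicalTriangulation

theorem apply_left (h : IsCanonicalTriangulation T Q R W) (x : M) : (Q x : H) = T x := by
  simpa using (h.apply_add x 0).symm

theorem apply_right (h : IsCanonicalTriangulation T Q R W) (y : L) :
    T y = (R y : H) + (W y : H) := by
  simpa using h.apply_add 0 y

theorem isClassC0 (h : IsCanonicalTriangulation T Q R W) (hT : ‖T‖ ≤ 1) : IsClassC0 Q := by
  refine ⟨ContinuousLinearMap.opNorm_le_bound _ zero_le_one fun x => ?_, fun x => ?_⟩
  · rw [one_mul, Submodule.coe_norm, h.apply_left]
    exact norm_apply_le_of_contraction hT _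
  · have hx := (mem_nullSpaceAL_iff hT).1 (h.null_eq.le x.2)
    rw [tendsto_subtype_rng]
    refine hx.congr fun n => ?_
    exact (map_pow_apply_of_intertwines (X := M.subtypeL) h.apply_left n x).symm

theorem mul_comm_left (h : IsCanonicalTriangulation T Q R W)
    (h' : IsCanonicalTriangulation T' Q' R' W) (hcomm : T * T' = T' * T) : Q * Q' = Q' * Q := by
  ext x
  change ((Q (Q' x) : M) : H) = (Q' (Q x) : M)
  rw [h.apply_left, h'.apply_left, h'.apply_left, h.apply_left]
  exact congrArg (fun B : H →L[ℂ] H => B x) hcomm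

theorem comp_sub_comp (h : IsCanonicalTriangulation T Q R W)
    (h' : IsCanonicalTriangulation T' Q' R' W) (hcomm : T * T' = T' * T) :
    Q ∘L R' - Q' ∘L R = (R' - R) ∘L W := by
  ext y
  have h1 : T (T' y) = T' (T y) := congrArg (fun B : H →L[ℂ] H => B y) hcomm
  rw [h.apply_right, h'.apply_right, h.apply_add, h'.apply_add] at h1
  change ((Q (R' y) - Q' (R y) : M) : H) = ((R' (W y) - R (W y) : M) : H)
  -- Both sides have the L-component W(Wy); only the M-components are compared.
  have h2 := add_right_cancel h1
  simp only [Submodule.coe_add, Submodule.coe_sub] at h2 ⊢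
  rw [sub_eq_sub_iff_add_eq_add, h2, add_comm]

theorem pow_apply_sub_mem (h : IsCanonicalTriangulation T Q R W) (n : ℕ) (y : L) :
    (T ^ n) (y : H) - ((W ^ n) y : L) ∈ M := by
  induction n with
  | zero => simp
  | succ n ih =>
    have h1 : (T ^ (n + 1)) (y : H) = T ((T ^ n) y) := by rw [pow_succ']; rfl
    have h2 : (W ^ (n + 1)) y = W ((W ^ n) y) := by rw [pow_succ']; rfl
    have h3 : T ((T ^ n) y) - (W ((W ^ n) y) : L) =
        (Q ⟨_, ih⟩ : H) + (R ((W ^ n) y) : H) := by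
      rw [h.apply_left, map_sub, h.apply_right]
      abel
    rw [h1, h2, h3]
    exact add_mem (Submodule.coe_mem _) (Submodule.coe_mem _)

theorem norm_apply_sq (h : IsCanonicalTriangulation T Q R W) (y : L) :
    ‖T y‖ ^ 2 = ‖R y‖ ^ 2 + ‖W y‖ ^ 2 := by
  rw [h.apply_right, pow_two, pow_two, pow_two, norm_add_sq_eq_norm_sq_add_norm_sq_of_inner_eq_zero
    (𝕜 := ℂ) _ _ (h.ortho.inner_eq (Submodule.coe_mem _) (Submodule.coe_mem _))]
  rfl

/-- Modulo N(S_T) the powers of W and T agree on L. If Wⁿy → 0, the form of T at y is at most ‖Wⁿy‖²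
→ 0, so y lies in M ∩ L = 0. -/
theorem isClassC1 (h : IsCanonicalTriangulation T Q R W) (hT : ‖T‖ ≤ 1) : IsClassC1 W := by
  refine ⟨ContinuousLinearMap.opNorm_le_bound _ zero_le_one fun y => ?_, fun y hy hlim => hy ?_⟩
  · rw [one_mul]
    refine le_trans ?_ (norm_apply_le_of_contraction hT (y : H))
    refine le_of_sq_le_sq ?_ (norm_nonneg _)
    rw [h.norm_apply_sq]
    exact le_add_of_nonneg_left (sq_nonneg _)
  · have h2 : Tendsto (fun n : ℕ => ‖(W ^ n) y‖ ^ 2) atTop (𝓝 0) := by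
      simpa using hlim.norm.pow 2
    have hform : asymptoticForm T y ≤ 0 := by
      refine ge_of_tendsto' h2 fun n => ?_
      have h3 := h.pow_apply_sub_mem n y
      rw [h.null_eq] at h3
      rw [← asymptoticForm_pow_apply hT (T' := T) (by simp) n y,
        asymptoticForm_eq_of_sub_mem hT h3]
      exact asymptoticForm_le hT _
    have hM : (y : H) ∈ M := h.null_eq.ge <| mem_nullSpaceAL_of_asymptoticForm_nonpos hT hform
    exact Subtype.ext (Submodule.disjoint_def.1 h.compl.disjoint _ hM y.2)

/-- Idempotency makes L invariant under T, so Ry = Ty - Wy lies in M ∩ L. -/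
theorem right_eq_zero (h : IsCanonicalTriangulation T Q R W) (hT : ‖T‖ ≤ 1)
    (hS : asymptoticLimit T = asymptoticLimit T ^ 2) : R = 0 := by
  ext y
  have h1 : T y ∈ L :=
    h.range_eq.ge (apply_mem_closedRangeAL_of_idempotent hT hS (h.range_eq.le y.2)).1
  have h2 : (R y : H) ∈ L := by
    rw [← add_sub_cancel_right (R y : H) (W y : H), ← h.apply_right]
    exact sub_mem h1 (Submodule.coe_mem _)
  exact Submodule.disjoint_def.1 h.compl.disjoint _ (Submodule.coe_mem _) h2

theorem apply_right_of_idempotent (h : IsCanonicalTriangulation T Q R W) (hT : ‖T‖ ≤ 1)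
    (hS : asymptoticLimit T = asymptoticLimit T ^ 2) (y : L) : (W y : H) = T y := by
  rw [h.apply_right, h.right_eq_zero hT hS]
  simp

theorem isometry (h : IsCanonicalTriangulation T Q R W) (hT : ‖T‖ ≤ 1)
    (hS : asymptoticLimit T = asymptoticLimit T ^ 2) : Isometry W := by
  refine AddMonoidHomClass.isometry_of_norm W fun y => ?_
  rw [Submodule.coe_norm, h.apply_right_of_idempotent hT hS]
  exact (apply_mem_closedRangeAL_of_idempotent hT hS (h.range_eq.le y.2)).2

end IsCanonicalTriangulation

end Triangulation

/-! ### The main theorem. -/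

theorem mainTheorem3 {H : Type*} [NormedAddCommGroup H] [InnerProductSpace ℂ H] [CompleteSpace H]
    (T T' : H →L[ℂ] H) (hT : ‖T‖ ≤ 1) (hT' : ‖T'‖ ≤ 1) (hcomm : T * T' = T' * T)
    (hdom : HarnackDominated T T') :
    nullSpaceAL T = nullSpaceAL T' ∧ closedRangeAL T = closedRangeAL T' ∧
    ∃ (Q Q' : nullSpaceAL T →L[ℂ] nullSpaceAL T)
      (R R' : closedRangeAL T →L[ℂ] nullSpaceAL T)
      (W : closedRangeAL T →L[ℂ] closedRangeAL T),
      IsCanonicalTriangulation T Q R W ∧ IsCanonicalTriangulation T' Q' R' W ∧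
      IsClassC0 Q ∧ IsClassC0 Q' ∧ Q * Q' = Q' * Q ∧ HarnackDominated Q Q' ∧
      IsClassC1 W ∧ Q ∘L R' - Q' ∘L R = (R' - R) ∘L W ∧
      (asymptoticLimit T = asymptoticLimit T ^ 2 ↔
        asymptoticLimit T' = asymptoticLimit T' ^ 2) ∧
      (asymptoticLimit T = asymptoticLimit T ^ 2 →
        asymptoticLimit T = asymptoticLimit T' ∧ Isometry W ∧ R = 0 ∧ R' = 0 ∧
        (HarnackEquivalent T T' ↔ HarnackDominated Q' Q)) := by
  have hnull := nullSpaceAL_eq_of_harnackDominated hT hT' hcomm hdom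
  have hrange : closedRangeAL T = closedRangeAL T' := by
    rw [closedRangeAL_eq_orthogonal hT, closedRangeAL_eq_orthogonal hT', hnull]
  have hsub := sub_apply_mem_nullSpaceAL_left hT hcomm hdom
  have hsub' : ∀ x, T' x - T x ∈ nullSpaceAL T' := fun x => by
    rw [← neg_sub]
    exact neg_mem (sub_apply_mem_nullSpaceAL_right hT hT' hcomm hdom x)
  have : CompleteSpace (closedRangeAL T) :=
    (Submodule.isClosed_topologicalClosure _).completeSpace_coe
  have h := isCanonicalTriangulation_compressionBlock (M := nullSpaceAL T)
    (L := closedRangeAL T) hT rfl rfl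
  have h' := isCanonicalTriangulation_compressionBlock (M := nullSpaceAL T)
    (L := closedRangeAL T) hT' hnull hrange
  -- T - T' maps into the orthogonal complement of L, so the two compressions to L coincide and both
  -- triangulations share W.
  rw [← compressionBlock_eq_of_sub_mem (closedRangeAL_eq_orthogonal hT) hsub] at h'
  have heq := asymptoticLimit_eq_of_idempotent hT hT' hnull hsub
  refine ⟨hnull, hrange, _, _, _, _, _, h, h', h.isClassC0 hT, h'.isClassC0 hT',
    h.mul_comm_left h' hcomm, hdom.restrict h.apply_left h'.apply_left, h.isClassC1 hT,
    h.comp_sub_comp h' hcomm, ⟨fun hS => ?_, fun hS => ?_⟩, fun hS => ?_⟩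
  · rwa [← heq hS]
  · rwa [← asymptoticLimit_eq_of_idempotent hT' hT hnull.symm hsub' hS]
  · have hS' : asymptoticLimit T' = asymptoticLimit T' ^ 2 := by rwa [← heq hS]
    exact ⟨heq hS, h.isometry hT hS, h.right_eq_zero hT hS, h'.right_eq_zero hT' hS',
      fun hE => hE.2.restrict h'.apply_left h.apply_left, fun hQ => ⟨hdom,
        hdom.symm_of_restrict h.apply_left h'.apply_left (h.apply_right_of_idempotent hT hS)
          (h'.apply_right_of_idempotent hT' hS') h.ortho h.compl hQ⟩⟩
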